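/- Let $A$ be a (complex, not necessarily unital) C*-algebra. Write $[x,y]=xy-yx$. For subsets $X,Y$ of a ring let $XY$ and $[X,Y]$ denote the additive subgroups generated by $\{xy : x\in X, y\in Y\}$ and $\{[x,y] : x\in X, y\in Y\}$, respectively, let $X^2=XX$, and let $\widetilde{A}$ denote the unitization of $A$ (so that $\widetilde{A}L\widetilde{A}$ is the ideal of $A$ generated by $L$ for a linear subspace $L\subseteq A$). Then the following are equivalent: (1) $A=\widetilde{A}[A,A]\widetilde{A}$, that is, $A$ is generated by its commutators as a (not necessarily closed) two-sided ideal. (2) $A=A[A,A]A$, that is, for every $a\in A$ there exist $n\in\mathbb{N}$ and $b_j,c_j,d_j,e_j\in A$, for $j=1,\ldots,n$, such that $a=\sum_{j=1}^n b_j[c_j,d_j]e_j$. (3) $A=A\big[[A,A],[A,A]\big]A$. (4) $A$ is generated by its commutators as a (not necessarily unital) ring. (5) $A=[A,A]^2$, that is, for every $a\in A$ there exist $n\in\mathbb{N}$ and $b_j,c_j,d_j,e_j\in A$, for $j=1,\ldots,n$, such that $a=\sum_{j=1}^n [b_j,c_j][d_j,e_j]$. Moreover, these conditions imply: (6) $A$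 admits no character, that is, no nonzero $*$-homomorphism $A\to\mathbb{C}$ (equivalently, no one-dimensional irreducible representation). Moreover, (6) implies that $A[A,A]A$ is dense in $A$, and if $A$ is unital, then all of the conditions (1)--(6) are equivalent. -/

import Mathlib

/-- For subsets `X`, `Y` of a ring, `XY`: the additive subgroup generated by the products
`x * y` with `x ∈ X` and `y ∈ Y`. -/
def mulSpan {R : Type*} [NonUnitalRing R] (X Y : Set R) : AddSubgroup R :=
  AddSubgroup.closure {z | ∃ x ∈ X, ∃ y ∈ Y, z = x * y}

/-- For subsets `X`, `Y` of a ring, `[X, Y]`: the additive subgroup generated by the commutators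
`⁅x, y⁆ = x * y - y * x` with `x ∈ X` and `y ∈ Y`. -/
def commSpan {R : Type*} [NonUnitalRing R] (X Y : Set R) : AddSubgroup R :=
  AddSubgroup.closure {z | ∃ x ∈ X, ∃ y ∈ Y, z = ⁅x, y⁆}

/-- The additive subgroup `[A, A]` generated by all commutators of the ring `A`. -/
def commSubgroup (A : Type*) [NonUnitalRing A] : AddSubgroup A :=
  commSpan (Set.univ : Set A) Set.univ

/-- The set of all commutators of the ring `A`. -/
def commSet (A : Type*) [NonUnitalRing A] : Set A :=
  {z | ∃ x y : A, z = ⁅x, y⁆}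

/-- The additive subgroup `A L A` for a subset `L` of the ring `A`. -/
def sandwich {A : Type*} [NonUnitalRing A] (L : Set A) : AddSubgroup A :=
  mulSpan (mulSpan Set.univ L) Set.univ

/-- `A` has a character: a nonzero ⋆-homomorphism to `ℂ` (that is, up to unitary equivalence, a
one-dimensional irreducible representation). -/
def HasCharacter (A : Type*) [NonUnitalCStarAlgebra A] : Prop :=
  ∃ χ : A →⋆ₙₐ[ℂ] ℂ, χ ≠ 0

/-!
A self-adjoint element `a` of a C⋆-algebra is divisible by every power of `f(a)`, where
`f(t) = 1 / log (1 + 1 / |t|)` vanishes at `0` more slowly than any power of `|t|`. Hence an ideal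
containing a power of each element of a C⋆-algebra is the whole algebra, although the ideals in
question need not be closed. This takes the place of a unit in the comparison of the conditions.

If `I = A[[A,A],[A,A]]A` missed all powers of some element, it would lie in a semiprime ideal `P`
that also misses them, by Zorn's lemma. In the semiprime ring `A/P` the commutators commute with
each other, and this forces `A/P` to be commutative, so `A[A,A]A ⊆ P`. This gives (2) ⟹ (3). For
(3) ⟹ (5), put `L = [A,A]`: then `A = A[L,L]A ⊆ L + L²`, so `L = [L + L²,A] = [L,A]`, hence
`L = [L,L + L²] ⊆ L²` and `A = L²`.

If `u b = b` and `b ∉ A[A,A]A`, then the left ideal of all `x` in the unitization with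
`A x b ⊆ A[A,A]A` is proper, and it contains all commutators and `u - 1`. By Gelfand–Mazur, the
quotient by a maximal left ideal above it is `ℂ`, which is a character with value `1` at `u`. Since
the elements `b` having such a `u` are dense among the self-adjoint elements, (6) makes `A[A,A]A`
dense.
-/

section AdditiveSpans

variable {R : Type*} [NonUnitalRing R] {L X Y : Set R} {S : AddSubgroup R}

lemma mul_mem_mulSpan {x y : R} (hx : x ∈ X) (hy : y ∈ Y) : x * y ∈ mulSpan X Y :=
  AddSubgroup.subset_closure ⟨x, hx, y, hy, rfl⟩

lemma mulSpan_le (h : ∀ x ∈ X, ∀ y ∈ Y, x * y ∈ S) : mulSpan X Y ≤ S := by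
  rw [mulSpan, AddSubgroup.closure_le]
  rintro _ ⟨x, hx, y, hy, rfl⟩
  exact h x hx y hy

lemma lie_mem_commSpan {x y : R} (hx : x ∈ X) (hy : y ∈ Y) : ⁅x, y⁆ ∈ commSpan X Y :=
  AddSubgroup.subset_closure ⟨x, hx, y, hy, rfl⟩

lemma commSpan_le (h : ∀ x ∈ X, ∀ y ∈ Y, ⁅x, y⁆ ∈ S) : commSpan X Y ≤ S := by
  rw [commSpan, AddSubgroup.closure_le]
  rintro _ ⟨x, hx, y, hy, rfl⟩
  exact h x hx y hy

lemma lie_mem_commSubgroup (x y : R) : ⁅x, y⁆ ∈ commSubgroup R :=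
  lie_mem_commSpan (Set.mem_univ x) (Set.mem_univ y)

lemma commSubgroup_le (h : ∀ x y : R, ⁅x, y⁆ ∈ S) : commSubgroup R ≤ S :=
  commSpan_le fun x _ y _ => h x y

lemma mul_mul_mem_sandwich {l : R} (hl : l ∈ L) (x y : R) : x * l * y ∈ sandwich L :=
  mul_mem_mulSpan (mul_mem_mulSpan (Set.mem_univ x) hl) (Set.mem_univ y)

lemma sandwich_le (h : ∀ l ∈ L, ∀ x y, x * l * y ∈ S) : sandwich L ≤ S := by
  refine mulSpan_le fun z hz y _ => ?_
  have hle : mulSpan Set.univ L ≤ S.comap (AddMonoidHom.mulRight y) :=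
    mulSpan_le fun x _ l hl => h l hl x y
  exact hle hz

lemma sandwich_commSpan_le (h : ∀ u ∈ X, ∀ v ∈ Y, ∀ x y, x * ⁅u, v⁆ * y ∈ S) :
    sandwich (commSpan X Y : Set R) ≤ S := by
  refine sandwich_le fun l hl x y => ?_
  have hle : commSpan X Y ≤
      S.comap ((AddMonoidHom.mulRight y).comp (AddMonoidHom.mulLeft x)) :=
    commSpan_le fun u hu v hv => h u hu v hv x y
  exact hle hl

lemma smul_mem_sandwich {𝕜 : Type*} [DistribSMul 𝕜 R] [IsScalarTower 𝕜 R R] (z : 𝕜) {x : R}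
    (hx : x ∈ sandwich L) : z • x ∈ sandwich L := by
  have hle : sandwich L ≤ (sandwich L).comap (DistribSMul.toAddMonoidHom R z) :=
    sandwich_le fun l hl x y => by
      simpa [smul_mul_assoc] using mul_mul_mem_sandwich hl (z • x) y
  exact hle hx

/-- The additive subgroup `R L R`, as a two-sided ideal of `R`. -/
def sandwichIdeal (L : Set R) : TwoSidedIdeal R :=
  .mk' (sandwich L) (zero_mem _) add_mem neg_mem
    (fun {w _} hz => sandwich_le (S := (sandwich L).comap (AddMonoidHom.mulLeft w))
      (fun l hl x y => by simpa [mul_assoc] using mul_mul_mem_sandwich hl (w * x) y) hz)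
    (fun {_ w} hz => sandwich_le (S := (sandwich L).comap (AddMonoidHom.mulRight w))
      (fun l hl x y => by simpa [mul_assoc] using mul_mul_mem_sandwich hl x (y * w)) hz)

lemma mem_sandwichIdeal {x : R} : x ∈ sandwichIdeal L ↔ x ∈ sandwich L :=
  TwoSidedIdeal.mem_mk' ..

lemma sandwichIdeal_le_iff {J : TwoSidedIdeal R} :
    sandwichIdeal L ≤ J ↔ ∀ l ∈ L, ∀ x y, x * l * y ∈ J :=
  ⟨fun h _ hl x y => h (mem_sandwichIdeal.2 (mul_mul_mem_sandwich hl x y)),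
    fun h _ hz => sandwich_le (S := .ofClass J) h (mem_sandwichIdeal.1 hz)⟩

lemma mul_mul_mem_sandwich_of_mem_span {z : R} (hz : z ∈ TwoSidedIdeal.span L) (x y : R) :
    x * z * y ∈ sandwich L := by
  induction hz using TwoSidedIdeal.span_induction generalizing x y with
  | mem l hl => exact mul_mul_mem_sandwich hl x y
  | zero => simp [zero_mem]
  | add z w _ _ ihz ihw => simpa [mul_add, add_mul] using add_mem (ihz x y) (ihw x y)
  | neg z _ ih => simpa using ih x y
  | left_absorb w z _ ih => simpa [mul_assoc] using ih (x * w) y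
  | right_absorb w z _ ih => simpa [mul_assoc] using ih x (w * y)

end AdditiveSpans

section FiniteSums

lemma addSubgroup_closure_eq_top_iff_exists_sum {G : Type*} [AddCommGroup G] {T : Set G}
    (hT : ∀ x ∈ T, -x ∈ T) :
    AddSubgroup.closure T = ⊤ ↔
      ∀ a, ∃ (n : ℕ) (t : Fin n → G), (∀ i, t i ∈ T) ∧ a = ∑ i, t i := by
  refine ⟨fun h a => ?_, fun h => (AddSubgroup.eq_top_iff' _).2 fun a => ?_⟩
  · induction (h ▸ AddSubgroup.mem_top a : a ∈ AddSubgroup.closure T)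
      using AddSubgroup.closure_induction with
    | mem x hx => exact ⟨1, fun _ => x, fun _ => hx, by simp⟩
    | zero => exact ⟨0, Fin.elim0, fun i => i.elim0, by simp⟩
    | add x y _ _ ihx ihy =>
      obtain ⟨m, s, hs, rfl⟩ := ihx
      obtain ⟨n, t, ht, rfl⟩ := ihy
      refine ⟨m + n, Fin.append s t, Fin.addCases ?_ ?_, by simp [Fin.sum_univ_add]⟩
      · simpa using hs
      · simpa using ht
    | neg x _ ih =>
      obtain ⟨n, t, ht, rfl⟩ := ih
      exact ⟨n, fun i => -t i, fun i => hT _ (ht i), by simp⟩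
  · obtain ⟨n, t, ht, rfl⟩ := h a
    exact sum_mem fun i _ => AddSubgroup.subset_closure (ht i)

variable {R : Type*} [NonUnitalRing R]

lemma sandwich_commSubgroup_eq_closure :
    sandwich (commSubgroup R : Set R) =
      AddSubgroup.closure {z | ∃ b c d e : R, z = b * ⁅c, d⁆ * e} := by
  refine le_antisymm (sandwich_commSpan_le fun c _ d _ b e =>
    AddSubgroup.subset_closure ⟨b, c, d, e, rfl⟩) ((AddSubgroup.closure_le _).2 ?_)
  rintro _ ⟨b, c, d, e, rfl⟩
  exact mul_mul_mem_sandwich (lie_mem_commSubgroup c d) b e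

lemma mulSpan_commSubgroup_eq_closure :
    mulSpan (commSubgroup R : Set R) (commSubgroup R : Set R) =
      AddSubgroup.closure {z | ∃ b c d e : R, z = ⁅b, c⁆ * ⁅d, e⁆} := by
  set S := AddSubgroup.closure {z | ∃ b c d e : R, z = ⁅b, c⁆ * ⁅d, e⁆}
  refine le_antisymm (mulSpan_le fun u hu v hv => ?_) ((AddSubgroup.closure_le _).2 ?_)
  · have lie_mul_mem : ∀ b c, commSubgroup R ≤ S.comap (AddMonoidHom.mulLeft ⁅b, c⁆) :=
      fun b c => commSubgroup_le fun d e => AddSubgroup.subset_closure ⟨b, c, d, e, rfl⟩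
    have mul_right_mem : commSubgroup R ≤ S.comap (AddMonoidHom.mulRight v) :=
      commSubgroup_le fun b c => lie_mul_mem b c hv
    exact mul_right_mem hu
  · rintro _ ⟨b, c, d, e, rfl⟩
    exact mul_mem_mulSpan (lie_mem_commSubgroup b c) (lie_mem_commSubgroup d e)

lemma sandwich_commSubgroup_eq_top_iff_exists_sum :
    sandwich (commSubgroup R : Set R) = ⊤ ↔
      ∀ a : R, ∃ (n : ℕ) (b c d e : Fin n → R), a = ∑ j, b j * ⁅c j, d j⁆ * e j := by
  rw [sandwich_commSubgroup_eq_closure, addSubgroup_closure_eq_top_iff_exists_sum]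
  · refine forall_congr' fun a => ⟨?_, ?_⟩
    · rintro ⟨n, t, ht, rfl⟩
      choose b c d e h using ht
      exact ⟨n, b, c, d, e, Finset.sum_congr rfl fun i _ => h i⟩
    · rintro ⟨n, b, c, d, e, rfl⟩
      exact ⟨n, _, fun i => ⟨b i, c i, d i, e i, rfl⟩, rfl⟩
  · rintro _ ⟨b, c, d, e, rfl⟩
    exact ⟨-b, c, d, e, by simp⟩

lemma mulSpan_commSubgroup_eq_top_iff_exists_sum :
    mulSpan (commSubgroup R : Set R) (commSubgroup R : Set R) = ⊤ ↔
      ∀ a : R, ∃ (n : ℕ) (b c d e : Fin n → R), a = ∑ j, ⁅b j, c j⁆ * ⁅d j, e j⁆ := by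
  rw [mulSpan_commSubgroup_eq_closure, addSubgroup_closure_eq_top_iff_exists_sum]
  · refine forall_congr' fun a => ⟨?_, ?_⟩
    · rintro ⟨n, t, ht, rfl⟩
      choose b c d e h using ht
      exact ⟨n, b, c, d, e, Finset.sum_congr rfl fun i _ => h i⟩
    · rintro ⟨n, b, c, d, e, rfl⟩
      exact ⟨n, _, fun i => ⟨b i, c i, d i, e i, rfl⟩, rfl⟩
  · rintro _ ⟨b, c, d, e, rfl⟩
    exact ⟨c, b, d, e, by rw [← neg_mul, Ring.lie_def, Ring.lie_def c, neg_sub]⟩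

end FiniteSums

section SquareOfCommutators

variable {R : Type*} [NonUnitalRing R]

lemma sandwich_commSpan_le_commSubgroup_sup_mulSpan (X Y : Set R) :
    sandwich (commSpan X Y : Set R) ≤ commSubgroup R ⊔ mulSpan Y (commSubgroup R : Set R) := by
  have lie_mul_mem : ∀ u ∈ X, ∀ v ∈ Y, ∀ a,
      ⁅u, v⁆ * a ∈ commSubgroup R ⊔ mulSpan Y (commSubgroup R : Set R) := by
    intro u _ v hv a
    have : ⁅u, v⁆ * a = ⁅u, v * a⁆ - v * ⁅u, a⁆ := by
      simp only [Ring.lie_def, mul_sub, sub_mul, mul_assoc]; abel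
    rw [this]
    exact sub_mem (AddSubgroup.mem_sup_left (lie_mem_commSubgroup _ _))
      (AddSubgroup.mem_sup_right (mul_mem_mulSpan hv (lie_mem_commSubgroup _ _)))
  refine sandwich_commSpan_le fun u hu v hv x y => ?_
  have : x * ⁅u, v⁆ * y = ⁅x, ⁅u, v⁆ * y⁆ + ⁅u, v⁆ * (y * x) := by
    simp only [Ring.lie_def, mul_sub, sub_mul, mul_assoc]; abel
  rw [this]
  exact add_mem (AddSubgroup.mem_sup_left (lie_mem_commSubgroup _ _)) (lie_mul_mem u hu v hv _)

lemma commSpan_self_le_mulSpan_self (X : Set R) : commSpan X X ≤ mulSpan X X :=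
  commSpan_le fun _ hx _ hy => sub_mem (mul_mem_mulSpan hx hy) (mul_mem_mulSpan hy hx)

lemma commSpan_sup_left_le (P Q : AddSubgroup R) (Z : Set R) :
    commSpan (P ⊔ Q : AddSubgroup R) Z ≤ commSpan (P : Set R) Z ⊔ commSpan (Q : Set R) Z := by
  refine commSpan_le fun x hx z hz => ?_
  obtain ⟨p, hp, q, hq, rfl⟩ := AddSubgroup.mem_sup.1 hx
  have : ⁅p + q, z⁆ = ⁅p, z⁆ + ⁅q, z⁆ := by
    simp only [Ring.lie_def, add_mul, mul_add]; abel
  rw [this]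
  exact AddSubgroup.add_mem_sup (lie_mem_commSpan hp hz) (lie_mem_commSpan hq hz)

lemma commSpan_sup_right_le (Z : Set R) (P Q : AddSubgroup R) :
    commSpan Z (P ⊔ Q : AddSubgroup R) ≤ commSpan Z (P : Set R) ⊔ commSpan Z (Q : Set R) := by
  refine commSpan_le fun z hz x hx => ?_
  obtain ⟨p, hp, q, hq, rfl⟩ := AddSubgroup.mem_sup.1 hx
  have : ⁅z, p + q⁆ = ⁅z, p⁆ + ⁅z, q⁆ := by
    simp only [Ring.lie_def, add_mul, mul_add]; abel
  rw [this]
  exact AddSubgroup.add_mem_sup (lie_mem_commSpan hz hp) (lie_mem_commSpan hz hq)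

lemma commSpan_mulSpan_self_le {X Y : Set R} (h : ∀ x ∈ X, ∀ y ∈ Y, ⁅x, y⁆ ∈ Y) :
    commSpan X (mulSpan Y Y : Set R) ≤ mulSpan Y Y := by
  refine commSpan_le fun x hx z hz => ?_
  have hle : mulSpan Y Y ≤
      (mulSpan Y Y).comap (AddMonoidHom.mulLeft x - AddMonoidHom.mulRight x) := by
    refine mulSpan_le fun y hy y' hy' => ?_
    have : x * (y * y') - y * y' * x = ⁅x, y⁆ * y' + y * ⁅x, y'⁆ := by
      simp only [Ring.lie_def, mul_sub, sub_mul, mul_assoc]; abel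
    change x * (y * y') - y * y' * x ∈ mulSpan Y Y
    rw [this]
    exact add_mem (mul_mem_mulSpan (h x hx y hy) hy') (mul_mem_mulSpan hy (h x hx y' hy'))
  exact hle hz

lemma commSpan_mulSpan_self_univ_le (X : Set R) :
    commSpan (mulSpan X X : Set R) Set.univ ≤ commSpan X Set.univ := by
  refine commSpan_le fun z hz a _ => ?_
  have hle : mulSpan X X ≤
      (commSpan X Set.univ).comap (AddMonoidHom.mulRight a - AddMonoidHom.mulLeft a) := by
    refine mulSpan_le fun x hx y hy => ?_
    have : x * y * a - a * (x * y) = ⁅x, y * a⁆ + ⁅y, a * x⁆ := by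
      simp only [Ring.lie_def, mul_assoc]; abel
    change x * y * a - a * (x * y) ∈ commSpan X Set.univ
    rw [this]
    exact add_mem (lie_mem_commSpan hx (Set.mem_univ _)) (lie_mem_commSpan hy (Set.mem_univ _))
  exact hle hz

lemma commSubgroup_le_mulSpan_of_sup_eq_top
    (h : commSubgroup R ⊔ mulSpan (commSubgroup R : Set R) (commSubgroup R : Set R) = ⊤) :
    commSubgroup R ≤ mulSpan (commSubgroup R : Set R) (commSubgroup R : Set R) := by
  set L := commSubgroup R with hL
  set Q := mulSpan (L : Set R) (L : Set R)
  have le_commSpan_univ : L ≤ commSpan (L : Set R) Set.univ := calc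
    L = commSpan (L ⊔ Q : AddSubgroup R) Set.univ := by
        rw [h, AddSubgroup.coe_top, hL, commSubgroup]
    _ ≤ commSpan (L : Set R) Set.univ ⊔ commSpan (Q : Set R) Set.univ :=
        commSpan_sup_left_le L Q Set.univ
    _ ≤ commSpan (L : Set R) Set.univ := sup_le le_rfl (commSpan_mulSpan_self_univ_le (L : Set R))
  calc
    L ≤ commSpan (L : Set R) (L ⊔ Q : AddSubgroup R) := by rwa [h, AddSubgroup.coe_top]
    _ ≤ commSpan (L : Set R) (L : Set R) ⊔ commSpan (L : Set R) (Q : Set R) :=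
        commSpan_sup_right_le (L : Set R) L Q
    _ ≤ Q := sup_le (commSpan_self_le_mulSpan_self (L : Set R))
        (commSpan_mulSpan_self_le fun x _ y _ => lie_mem_commSubgroup x y)

theorem mulSpan_commSubgroup_eq_top_of_sandwich_commSpan_eq_top
    (h : sandwich (commSpan (commSubgroup R : Set R) (commSubgroup R : Set R) : Set R) = ⊤) :
    mulSpan (commSubgroup R : Set R) (commSubgroup R : Set R) = ⊤ := by
  have sup_eq_top := top_le_iff.1
    (h.ge.trans (sandwich_commSpan_le_commSubgroup_sup_mulSpan _ _))
  rwa [sup_eq_right.2 (commSubgroup_le_mulSpan_of_sup_eq_top sup_eq_top)] at sup_eq_top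

end SquareOfCommutators

section SemiprimeIdeals

variable {R : Type*} [NonUnitalRing R]

/-- A two-sided ideal `P` is semiprime if `x R x ⊆ P` implies `x ∈ P`. The ring itself is counted as
a semiprime ideal. -/
def IsSemiprimeIdeal (P : TwoSidedIdeal R) : Prop :=
  ∀ x, (∀ y, x * y * x ∈ P) → x ∈ P

lemma IsSemiprimeIdeal.mem_of_mul_mul_mem {P : TwoSidedIdeal R} (hP : IsSemiprimeIdeal P) {x : R}
    (h : ∀ y z, y * x * z ∈ P) : x ∈ P :=
  hP x fun y => hP _ fun z => by simpa only [mul_assoc] using h (x * y) (z * (x * (y * x)))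

lemma exists_twoSidedIdeal_eq_sUnion {c : Set (TwoSidedIdeal R)} (hne : c.Nonempty)
    (hc : IsChain (· ≤ ·) c) : ∃ J : TwoSidedIdeal R, ∀ x, x ∈ J ↔ ∃ I ∈ c, x ∈ I := by
  refine ⟨.mk' {x | ∃ I ∈ c, x ∈ I} ?_ ?_ ?_ ?_ ?_, fun x => TwoSidedIdeal.mem_mk' ..⟩
  · exact hne.imp fun I hI => ⟨hI, I.zero_mem⟩
  · rintro x y ⟨I, hI, hx⟩ ⟨J, hJ, hy⟩
    rcases hc.total hI hJ with hIJ | hJI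
    · exact ⟨J, hJ, J.add_mem (hIJ hx) hy⟩
    · exact ⟨I, hI, I.add_mem hx (hJI hy)⟩
  · exact fun ⟨I, hI, hx⟩ => ⟨I, hI, I.neg_mem hx⟩
  · exact fun ⟨I, hI, hy⟩ => ⟨I, hI, I.mul_mem_left _ _ hy⟩
  · exact fun ⟨I, hI, hx⟩ => ⟨I, hI, I.mul_mem_right _ _ hx⟩

lemma mul_mul_mem_of_mem_span_left {P : TwoSidedIdeal R} {x w : R} (h : ∀ y, x * y * w ∈ P)
    {z : R} (hz : z ∈ TwoSidedIdeal.span {x}) (y : R) : z * y * w ∈ P := by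
  induction hz using TwoSidedIdeal.span_induction generalizing y with
  | mem z hz => exact hz ▸ h y
  | zero => simp [P.zero_mem]
  | add z z' _ _ ih ih' => simpa [add_mul] using P.add_mem (ih y) (ih' y)
  | neg z _ ih => simpa using P.neg_mem (ih y)
  | left_absorb r z _ ih => simpa [mul_assoc] using P.mul_mem_left r _ (ih y)
  | right_absorb r z _ ih => simpa [mul_assoc] using ih (r * y)

lemma mul_mul_mem_of_mem_span_right {P : TwoSidedIdeal R} {x z : R} (h : ∀ y, z * y * x ∈ P)
    {w : R} (hw : w ∈ TwoSidedIdeal.span {x}) (y : R) : z * y * w ∈ P := by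
  induction hw using TwoSidedIdeal.span_induction generalizing y with
  | mem w hw => exact hw ▸ h y
  | zero => simp [P.zero_mem]
  | add w w' _ _ ih ih' => simpa [mul_add] using P.add_mem (ih y) (ih' y)
  | neg w _ ih => simpa using P.neg_mem (ih y)
  | left_absorb r w _ ih => simpa [mul_assoc] using ih (y * r)
  | right_absorb r w _ ih => simpa [mul_assoc] using P.mul_mem_right _ r (ih y)

lemma mul_mul_mem_of_mem_sup_span {P : TwoSidedIdeal R} {x : R} (h : ∀ y, x * y * x ∈ P) {s : R}
    (hs : s ∈ P ⊔ TwoSidedIdeal.span {x}) (y : R) : s * y * s ∈ P := by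
  obtain ⟨p, hp, z, hz, rfl⟩ := TwoSidedIdeal.mem_sup.1 hs
  have hzz : z * y * z ∈ P :=
    mul_mul_mem_of_mem_span_right (fun y => mul_mul_mem_of_mem_span_left h hz y) hz y
  have : (p + z) * y * (p + z) = p * (y * (p + z)) + (z * y * p + z * y * z) := by
    simp only [add_mul, mul_add, mul_assoc]; abel
  rw [this]
  exact P.add_mem (P.mul_mem_right _ _ hp) (P.add_mem (P.mul_mem_left _ _ hp) hzz)

theorem exists_isSemiprimeIdeal_ge_disjoint {I : TwoSidedIdeal R} {S : Subsemigroup R}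
    (hIS : ∀ s ∈ S, s ∉ I) :
    ∃ P, I ≤ P ∧ IsSemiprimeIdeal P ∧ ∀ s ∈ S, s ∉ P := by
  obtain ⟨P, hIP, hP⟩ : ∃ P, I ≤ P ∧ Maximal (fun J : TwoSidedIdeal R => ∀ s ∈ S, s ∉ J) P := by
    refine zorn_le_nonempty₀ {J | ∀ s ∈ S, s ∉ J} (fun c hcS hc J hJ => ?_) I hIS
    obtain ⟨U, hU⟩ := exists_twoSidedIdeal_eq_sUnion ⟨J, hJ⟩ hc
    refine ⟨U, fun s hs hsU => ?_, fun K hK x hx => (hU x).2 ⟨K, hK, hx⟩⟩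
    obtain ⟨K, hK, hsK⟩ := (hU s).1 hsU
    exact hcS hK s hs hsK
  refine ⟨P, hIP, fun x hx => by_contra fun hxP => ?_, hP.prop⟩
  obtain ⟨s, hs, hsP⟩ : ∃ s ∈ S, s ∈ P ⊔ TwoSidedIdeal.span {x} := by
    by_contra! hdisj
    exact hxP (hP.le_of_ge hdisj le_sup_left
      ((le_sup_right : _ ≤ P ⊔ _) (TwoSidedIdeal.subset_span (Set.mem_singleton x))))
  exact hP.prop _ (mul_mem (mul_mem hs hs) hs) (mul_mul_mem_of_mem_sup_span hx hsP s)

lemma IsSemiprimeIdeal.lie_mem_of_mem_commSubgroup {P : TwoSidedIdeal R} (hP : IsSemiprimeIdeal P)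
    (h : ∀ u ∈ commSubgroup R, ∀ v ∈ commSubgroup R, ⁅u, v⁆ ∈ P) {v : R}
    (hv : v ∈ commSubgroup R) (a : R) : ⁅v, a⁆ ∈ P := by
  have lie_mul_lie_mem : ∀ x, ⁅a, x⁆ * ⁅v, a⁆ ∈ P := fun x => by
    have : ⁅a, x⁆ * ⁅v, a⁆ = ⁅v, ⁅a, x * a⁆⁆ - ⁅v, ⁅a, x⁆⁆ * a := by
      simp only [Ring.lie_def, mul_sub, sub_mul, mul_assoc]; abel
    rw [this]
    exact P.sub_mem (h v hv _ (lie_mem_commSubgroup _ _))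
      (P.mul_mem_right _ _ (h v hv _ (lie_mem_commSubgroup _ _)))
  refine hP _ fun y => ?_
  have : ⁅v, a⁆ * y * ⁅v, a⁆ = v * (⁅a, y⁆ * ⁅v, a⁆) - ⁅a, v * y⁆ * ⁅v, a⁆ := by
    simp only [Ring.lie_def, mul_sub, sub_mul, mul_assoc]; abel
  rw [this]
  exact P.sub_mem (P.mul_mem_left _ _ (lie_mul_lie_mem y)) (lie_mul_lie_mem _)

theorem IsSemiprimeIdeal.lie_mem {P : TwoSidedIdeal R} (hP : IsSemiprimeIdeal P)
    (h : ∀ u ∈ commSubgroup R, ∀ v ∈ commSubgroup R, ⁅u, v⁆ ∈ P) (a b : R) : ⁅a, b⁆ ∈ P := by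
  have central : ∀ x y z, ⁅⁅x, y⁆, z⁆ ∈ P := fun x y z =>
    hP.lie_mem_of_mem_commSubgroup h (lie_mem_commSubgroup x y) z
  have sq_mem : ⁅a, b⁆ * ⁅a, b⁆ ∈ P := by
    have : ⁅a, b⁆ * ⁅a, b⁆ = ⁅⁅a, b * a⁆, b⁆ - ⁅⁅a, b⁆, b⁆ * a := by
      simp only [Ring.lie_def, mul_sub, sub_mul, mul_assoc]; abel
    rw [this]
    exact P.sub_mem (central _ _ _) (P.mul_mem_right _ _ (central _ _ _))
  refine hP _ fun y => ?_
  have : ⁅a, b⁆ * y * ⁅a, b⁆ = ⁅a, b⁆ * ⁅a, b⁆ * y - ⁅a, b⁆ * ⁅⁅a, b⁆, y⁆ := by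
    simp only [Ring.lie_def, mul_sub, sub_mul, mul_assoc]; abel
  rw [this]
  exact P.sub_mem (P.mul_mem_right _ _ sq_mem) (P.mul_mem_left _ _ (central _ _ _))

lemma IsSemiprimeIdeal.sandwichIdeal_commSubgroup_le {P : TwoSidedIdeal R}
    (hP : IsSemiprimeIdeal P)
    (h : sandwichIdeal (commSpan (commSubgroup R : Set R) (commSubgroup R : Set R)) ≤ P) :
    sandwichIdeal (commSubgroup R : Set R) ≤ P := by
  have lie_lie_mem : ∀ u ∈ commSubgroup R, ∀ v ∈ commSubgroup R, ⁅u, v⁆ ∈ P :=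
    fun u hu v hv => hP.mem_of_mul_mul_mem (sandwichIdeal_le_iff.1 h _ (lie_mem_commSpan hu hv))
  have commSubgroup_le : commSubgroup R ≤ .ofClass P :=
    commSubgroup_le (hP.lie_mem lie_lie_mem)
  exact sandwichIdeal_le_iff.2 fun u hu x y =>
    P.mul_mem_right _ _ (P.mul_mem_left _ _ (commSubgroup_le hu))

end SemiprimeIdeals

section NilQuotients

variable {R : Type*} [NonUnitalRing R]

/-- The quotient `R / I` is a nil ring. Nonempty multiplicatively closed sets take the place of the
sequences of powers of an element, which are not available in a non-unital ring. -/
def HasNilQuotient (I : TwoSidedIdeal R) : Prop :=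
  ∀ S : Subsemigroup R, (S : Set R).Nonempty → ∃ s ∈ S, s ∈ I

variable (R) in
/-- The ring `R` has no nonzero nil quotient. For C⋆-algebras, this takes the place of the existence
of a unit. -/
def HasNoNilQuotient : Prop :=
  ∀ I : TwoSidedIdeal R, HasNilQuotient I → I = ⊤

lemma sandwichIdeal_eq_top_iff {L : Set R} : sandwichIdeal L = ⊤ ↔ sandwich L = ⊤ := by
  simp only [SetLike.ext_iff, mem_sandwichIdeal, TwoSidedIdeal.mem_top, AddSubgroup.mem_top]

theorem hasNilQuotient_sandwichIdeal_univ : HasNilQuotient (sandwichIdeal (Set.univ : Set R)) :=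
  fun _ ⟨s, hs⟩ => ⟨s * s * s, mul_mem (mul_mem hs hs) hs,
    mem_sandwichIdeal.2 (mul_mul_mem_sandwich (Set.mem_univ s) s s)⟩

theorem hasNilQuotient_sandwichIdeal_commSpan (h : sandwich (commSubgroup R : Set R) = ⊤) :
    HasNilQuotient (sandwichIdeal
      (commSpan (commSubgroup R : Set R) (commSubgroup R : Set R) : Set R)) := by
  intro S ⟨s, hs⟩
  by_contra! hdisj
  obtain ⟨P, hIP, hP, hPS⟩ := exists_isSemiprimeIdeal_ge_disjoint hdisj
  have top_le : ⊤ ≤ P :=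
    (sandwichIdeal_eq_top_iff.2 h).ge.trans (hP.sandwichIdeal_commSubgroup_le hIP)
  exact hPS s hs (top_le trivial)

namespace HasNoNilQuotient

variable (hR : HasNoNilQuotient R)
include hR

lemma sandwich_univ_eq_top : sandwich (Set.univ : Set R) = ⊤ :=
  sandwichIdeal_eq_top_iff.1 (hR _ hasNilQuotient_sandwichIdeal_univ)

lemma sandwich_commSpan_eq_top (h : sandwich (commSubgroup R : Set R) = ⊤) :
    sandwich (commSpan (commSubgroup R : Set R) (commSubgroup R : Set R) : Set R) = ⊤ :=
  sandwichIdeal_eq_top_iff.1 (hR _ (hasNilQuotient_sandwichIdeal_commSpan h))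

lemma sandwich_eq_top_of_span_eq_top {L : Set R} (h : TwoSidedIdeal.span L = ⊤) :
    sandwich L = ⊤ :=
  top_le_iff.1 <| hR.sandwich_univ_eq_top.ge.trans <| sandwich_le fun _ _ =>
    mul_mul_mem_sandwich_of_mem_span (h ▸ trivial)

end HasNoNilQuotient

end NilQuotients

section EmbeddingsAsIdeals

variable {R T : Type*} [NonUnitalRing R] [NonUnitalRing T] {φ : R →ₙ+* T} {L : Set R}

lemma map_mem_sandwich_image {a : R} (ha : a ∈ sandwich L) : φ a ∈ sandwich (φ '' L) := by
  have hle : sandwich L ≤ (sandwich (φ '' L)).comap (φ : R →+ T) := sandwich_le fun l hl x y => by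
    simpa using mul_mul_mem_sandwich (Set.mem_image_of_mem φ hl) (φ x) (φ y)
  exact hle ha

variable (hleft : ∀ t r, t * φ r ∈ Set.range φ) (hright : ∀ r t, φ r * t ∈ Set.range φ)
include hleft hright

lemma sandwich_image_subset_range : (sandwich (φ '' L) : Set T) ⊆ Set.range φ := by
  have hle : sandwich (φ '' L) ≤ (φ : R →+ T).range := by
    refine sandwich_le ?_
    rintro _ ⟨l, -, rfl⟩ s t
    obtain ⟨r, hr⟩ := hleft s l
    exact hr ▸ hright r t
  exact hle

lemma map_mul_mul_map_mem_map_sandwich {t : T} (ht : t ∈ sandwich (φ '' L)) (x y : R) :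
    φ x * t * φ y ∈ (sandwich L).map (φ : R →+ T) := by
  have hle : sandwich (φ '' L) ≤ ((sandwich L).map (φ : R →+ T)).comap
      ((AddMonoidHom.mulRight (φ y)).comp (AddMonoidHom.mulLeft (φ x))) := by
    refine sandwich_le ?_
    rintro _ ⟨l, hl, rfl⟩ s t
    obtain ⟨x', hx'⟩ := hright x s
    obtain ⟨y', hy'⟩ := hleft t y
    exact ⟨x' * l * y', mul_mul_mem_sandwich hl x' y', by simp [hx', hy', mul_assoc]⟩
  exact hle ht

lemma coe_sandwich_image_eq_range_iff (hR : sandwich (Set.univ : Set R) = ⊤)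
    (hφ : Function.Injective φ) :
    (sandwich (φ '' L) : Set T) = Set.range φ ↔ sandwich L = ⊤ := by
  refine ⟨fun h => top_le_iff.1 <| hR.ge.trans <| sandwich_le fun z _ x y => ?_, fun h =>
    (sandwich_image_subset_range hleft hright).antisymm ?_⟩
  · have hz : φ z ∈ (sandwich (φ '' L) : Set T) := h ▸ Set.mem_range_self z
    obtain ⟨r, hr, hxyz⟩ := map_mul_mul_map_mem_map_sandwich hleft hright hz x y
    rw [← map_mul, ← map_mul] at hxyz
    exact hφ hxyz ▸ hr
  · rintro _ ⟨a, rfl⟩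
    exact map_mem_sandwich_image (h ▸ AddSubgroup.mem_top a)

end EmbeddingsAsIdeals

lemma unitization_inr_snd_of_fst_eq_zero {𝕜 R : Type*} [Zero 𝕜] {x : Unitization 𝕜 R}
    (hx : x.fst = 0) : (x.snd : Unitization 𝕜 R) = x :=
  Unitization.ext hx.symm rfl

section Equivalences

variable {R : Type*} [NonUnitalRing R]

lemma twoSidedIdeal_span_eq_top_of_nonUnitalSubring_closure_eq_top {T : Set R}
    (h : NonUnitalSubring.closure T = ⊤) : TwoSidedIdeal.span T = ⊤ := by
  refine top_le_iff.1 fun a _ => ?_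
  induction (h ▸ NonUnitalSubring.mem_top a : a ∈ NonUnitalSubring.closure T)
    using NonUnitalSubring.closure_induction with
  | mem x hx => exact TwoSidedIdeal.subset_span hx
  | zero => exact zero_mem _
  | add x y _ _ hx hy => exact add_mem (hx trivial) (hy trivial)
  | neg x _ hx => exact neg_mem (hx trivial)
  | mul x y _ _ hx _ => exact TwoSidedIdeal.mul_mem_right _ _ _ (hx trivial)

lemma mulSpan_commSubgroup_le_nonUnitalSubring_closure :
    mulSpan (commSubgroup R : Set R) (commSubgroup R : Set R) ≤
      (NonUnitalSubring.closure (commSet R)).toAddSubgroup := by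
  have hle : commSubgroup R ≤ (NonUnitalSubring.closure (commSet R)).toAddSubgroup :=
    commSubgroup_le fun x y => NonUnitalSubring.subset_closure ⟨x, y, rfl⟩
  exact mulSpan_le fun x hx y hy => mul_mem (S := NonUnitalSubring R) (hle hx) (hle hy)

variable (𝕜 : Type*) [CommRing 𝕜] [Module 𝕜 R] [IsScalarTower 𝕜 R R] [SMulCommClass 𝕜 R R]

lemma coe_sandwich_image_inr_eq_range_iff (hR : sandwich (Set.univ : Set R) = ⊤) (L : Set R) :
    (sandwich ((fun a : R => (a : Unitization 𝕜 R)) '' L) : Set (Unitization 𝕜 R)) =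
      Set.range (fun a : R => (a : Unitization 𝕜 R)) ↔ sandwich L = ⊤ := by
  let ι : R →ₙ+* Unitization 𝕜 R :=
    { toFun := Unitization.inr
      map_mul' := Unitization.inr_mul 𝕜
      map_zero' := Unitization.inr_zero 𝕜
      map_add' := Unitization.inr_add 𝕜 }
  have coe_ι : (fun a : R => (a : Unitization 𝕜 R)) = ι := rfl
  have mul_mem_range : ∀ t r, t * ι r ∈ Set.range ι := fun t r =>
    ⟨_, unitization_inr_snd_of_fst_eq_zero (by simp [← coe_ι])⟩
  have mem_range_mul : ∀ r t, ι r * t ∈ Set.range ι := fun r t =>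
    ⟨_, unitization_inr_snd_of_fst_eq_zero (by simp [← coe_ι])⟩
  rw [coe_ι]
  exact coe_sandwich_image_eq_range_iff mul_mem_range mem_range_mul hR Unitization.inr_injective

theorem HasNoNilQuotient.tfae_generated_by_commutators (hR : HasNoNilQuotient R) :
    List.TFAE [
      (sandwich ((fun a : R => (a : Unitization 𝕜 R)) '' (commSubgroup R : Set R)) :
        Set (Unitization 𝕜 R)) = Set.range (fun a : R => (a : Unitization 𝕜 R)),
      TwoSidedIdeal.span (commSet R) = ⊤,
      sandwich (commSubgroup R : Set R) = ⊤,
      ∀ a : R, ∃ (n : ℕ) (b c d e : Fin n → R), a = ∑ j, b j * ⁅c j, d j⁆ * e j,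
      sandwich (commSpan (commSubgroup R : Set R) (commSubgroup R : Set R) : Set R) = ⊤,
      NonUnitalSubring.closure (commSet R) = ⊤,
      mulSpan (commSubgroup R : Set R) (commSubgroup R : Set R) = ⊤,
      ∀ a : R, ∃ (n : ℕ) (b c d e : Fin n → R), a = ∑ j, ⁅b j, c j⁆ * ⁅d j, e j⁆] := by
  tfae_have 1 ↔ 3 := coe_sandwich_image_inr_eq_range_iff 𝕜 hR.sandwich_univ_eq_top _
  tfae_have 2 → 3 := fun h => top_le_iff.1 <|
    (hR.sandwich_eq_top_of_span_eq_top h).ge.trans <| sandwich_le <| by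
      rintro _ ⟨c, d, rfl⟩
      exact mul_mul_mem_sandwich (lie_mem_commSubgroup c d)
  tfae_have 3 ↔ 4 := sandwich_commSubgroup_eq_top_iff_exists_sum
  tfae_have 3 → 5 := hR.sandwich_commSpan_eq_top
  tfae_have 5 → 7 := mulSpan_commSubgroup_eq_top_of_sandwich_commSpan_eq_top
  tfae_have 7 ↔ 8 := mulSpan_commSubgroup_eq_top_iff_exists_sum
  tfae_have 7 → 6 := fun h => top_le_iff.1 <|
    h.ge.trans mulSpan_commSubgroup_le_nonUnitalSubring_closure
  tfae_have 6 → 2 := twoSidedIdeal_span_eq_top_of_nonUnitalSubring_closure_eq_top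
  tfae_finish

end Equivalences

section LogarithmicCutoff

open Filter Topology

lemma log_one_add_inv_abs_pos {t : ℝ} (ht : t ≠ 0) : 0 < Real.log (1 + |t|⁻¹) :=
  Real.log_pos (lt_add_of_pos_right 1 (by positivity))

lemma continuousAt_log_one_add_inv_abs {t : ℝ} (ht : t ≠ 0) :
    ContinuousAt (fun t : ℝ => Real.log (1 + |t|⁻¹)) t :=
  (continuousAt_const.add (continuous_abs.continuousAt.inv₀ (abs_ne_zero.2 ht))).log
    (by positivity : (0 : ℝ) < 1 + |t|⁻¹).ne'

lemma tendsto_one_add_inv_abs_nhdsNE_zero :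
    Tendsto (fun t : ℝ => 1 + |t|⁻¹) (𝓝[≠] 0) atTop :=
  tendsto_atTop_add_const_left _ _ <| by
    simpa using tendsto_norm_inv_nhdsNE_zero_atTop (α := ℝ)

lemma continuous_inv_log_one_add_inv_abs :
    Continuous fun t : ℝ => (Real.log (1 + |t|⁻¹))⁻¹ := by
  refine continuous_iff_continuousAt.2 fun t => ?_
  rcases eq_or_ne t 0 with rfl | ht
  · rw [continuousAt_iff_punctured_nhds]
    simpa [Function.comp_def] using tendsto_inv_atTop_zero.comp
      (Real.tendsto_log_atTop.comp tendsto_one_add_inv_abs_nhdsNE_zero)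
  · exact (continuousAt_log_one_add_inv_abs ht).inv₀ (log_one_add_inv_abs_pos ht).ne'

lemma continuous_mul_log_one_add_inv_abs_pow (n : ℕ) :
    Continuous fun t : ℝ => t * Real.log (1 + |t|⁻¹) ^ n := by
  refine continuous_iff_continuousAt.2 fun t => ?_
  rcases eq_or_ne t 0 with rfl | ht
  · have log_pow_div_tendsto : Tendsto (fun t : ℝ => Real.log (1 + |t|⁻¹) ^ n / (1 + |t|⁻¹))
        (𝓝[≠] 0) (𝓝 0) :=
      (Real.isLittleO_pow_log_id_atTop (n := n)).tendsto_div_nhds_zero.comp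
        tendsto_one_add_inv_abs_nhdsNE_zero
    have abs_add_one_tendsto : Tendsto (fun t : ℝ => |t| + 1) (𝓝[≠] 0) (𝓝 (|0| + 1)) :=
      (continuous_abs.add continuous_const).continuousAt.continuousWithinAt
    rw [continuousAt_iff_punctured_nhds, zero_mul, tendsto_zero_iff_abs_tendsto_zero]
    refine ((zero_mul (|0| + 1 : ℝ)) ▸ log_pow_div_tendsto.mul abs_add_one_tendsto).congr' ?_
    filter_upwards [self_mem_nhdsWithin] with t ht
    have : |t| ≠ 0 := abs_ne_zero.2 ht
    have : 0 < Real.log (1 + |t|⁻¹) := log_one_add_inv_abs_pos ht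
    rw [Function.comp, abs_mul, abs_pow, abs_of_pos this]
    field_simp
  · exact continuousAt_id.mul ((continuousAt_log_one_add_inv_abs ht).pow n)

end LogarithmicCutoff

section Divisibility

variable {A : Type*} [NonUnitalCStarAlgebra A]

lemma mem_of_forall_smul_selfAdjoint_mem {σ : Type*} [SetLike σ A] [AddMemClass σ A] {S : σ}
    (h : ∀ (z : ℂ) (a : A), IsSelfAdjoint a → z • a ∈ S) (a : A) : a ∈ S := by
  rw [← realPart_add_I_smul_imaginaryPart a]
  refine add_mem ?_ (h _ _ (imaginaryPart a).2)
  simpa using h 1 _ (realPart a).2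

theorem exists_subsemigroup_forall_exists_mul_eq {a : A} (ha : IsSelfAdjoint a) :
    ∃ S : Subsemigroup A, (S : Set A).Nonempty ∧ ∀ s ∈ S, ∃ c, s * c = a := by
  -- Since `|0|⁻¹ = 0` and `log 1 = 0`, both functions vanish at `0`.
  let f (n : ℕ) (t : ℝ) : ℝ := (Real.log (1 + |t|⁻¹))⁻¹ ^ (n + 1)
  let g (n : ℕ) (t : ℝ) : ℝ := t * Real.log (1 + |t|⁻¹) ^ (n + 1)
  have hf : ∀ n, Continuous (f n) := fun n => continuous_inv_log_one_add_inv_abs.pow (n + 1)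
  have hg : ∀ n, Continuous (g n) := fun n => continuous_mul_log_one_add_inv_abs_pow (n + 1)
  have hf0 : ∀ n, f n 0 = 0 := by simp [f]
  have hg0 : ∀ n, g n 0 = 0 := by simp [g]
  refine ⟨⟨Set.range fun n => cfcₙ (f n) a, ?_⟩, Set.range_nonempty _, ?_⟩
  · rintro _ _ ⟨m, rfl⟩ ⟨n, rfl⟩
    refine ⟨m + n + 1, ?_⟩
    rw [← cfcₙ_mul _ _ a (hf m).continuousOn (hf0 m) (hf n).continuousOn (hf0 n)]
    exact congrArg (cfcₙ · a) (funext fun t => by simp only [f]; ring)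
  · rintro _ ⟨n, rfl⟩
    refine ⟨cfcₙ (g n) a, ?_⟩
    rw [← cfcₙ_mul _ _ a (hf n).continuousOn (hf0 n) (hg n).continuousOn (hg0 n)]
    conv_rhs => rw [← cfcₙ_id' ℝ a]
    refine cfcₙ_congr fun t _ => ?_
    rcases eq_or_ne t 0 with rfl | ht
    · simp [hf0]
    · have pow_ne_zero := pow_ne_zero (n + 1) (log_one_add_inv_abs_pos ht).ne'
      simp only [f, g]
      rw [inv_pow, mul_left_comm, inv_mul_cancel₀ pow_ne_zero, mul_one]

variable (A) in
theorem hasNoNilQuotient_of_nonUnitalCStarAlgebra : HasNoNilQuotient A := by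
  refine fun I hI => top_le_iff.1 fun a _ =>
    mem_of_forall_smul_selfAdjoint_mem (fun z a ha => ?_) a
  obtain ⟨S, hS, hdvd⟩ := exists_subsemigroup_forall_exists_mul_eq ha
  obtain ⟨s, hs, hsI⟩ := hI S hS
  obtain ⟨c, rfl⟩ := hdvd s hs
  rw [← mul_smul_comm]
  exact I.mul_mem_right _ _ hsI

lemma mem_closure_setOf_exists_mul_eq {a : A} (ha : IsSelfAdjoint a) :
    a ∈ closure {b : A | ∃ u, u * b = b} := by
  refine (mem_closure_iff_nhds_basis Metric.nhds_basis_closedBall).2 fun ε hε => ?_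
  let clip (t : ℝ) : ℝ := max (-ε) (min t ε)
  have hf : Continuous fun t => t - clip t := by fun_prop
  have hu : Continuous fun t : ℝ => min 1 (|t| / ε) := by fun_prop
  have hf0 : 0 - clip 0 = 0 := by simp [clip, hε.le]
  have clip_of_abs_le {t : ℝ} (ht : |t| ≤ ε) : clip t = t := by
    rw [abs_le] at ht
    simp only [clip, min_eq_left ht.2, max_eq_right ht.1]
  have abs_clip_le (t : ℝ) : |clip t| ≤ ε :=
    abs_le.2 ⟨le_max_left _ _, max_le (by linarith) (min_le_right _ _)⟩
  -- Where `t - clip t ≠ 0`, we have `min 1 (|t| / ε) = 1`.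
  refine ⟨cfcₙ (fun t => t - clip t) a, ⟨cfcₙ (fun t : ℝ => min 1 (|t| / ε)) a, ?_⟩, ?_⟩
  · rw [← cfcₙ_mul _ _ a hu.continuousOn (by simp) hf.continuousOn hf0]
    refine cfcₙ_congr fun t _ => ?_
    rcases le_total ε |t| with h | h
    · rw [min_eq_left ((one_le_div hε).2 h), one_mul]
    · rw [clip_of_abs_le h, sub_self, mul_zero]
  · have sub_cfcₙ_eq : a - cfcₙ (fun t => t - clip t) a = cfcₙ clip a := by
      conv_lhs => enter [1]; rw [← cfcₙ_id' ℝ a]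
      rw [← cfcₙ_sub (fun t : ℝ => t) _ a continuousOn_id rfl hf.continuousOn hf0]
      simp only [sub_sub_cancel]
    rw [mem_closedBall_iff_norm', sub_cfcₙ_eq]
    exact norm_cfcₙ_le fun t _ => abs_clip_le t

end Divisibility

section GelfandMazur

lemma isTwoSided_of_lie_mem {B : Type*} [Ring B] {M : Ideal B} (hcomm : ∀ x y : B, ⁅x, y⁆ ∈ M) :
    M.IsTwoSided := by
  refine ⟨fun {x} y hx => ?_⟩
  rw [← sub_add_cancel (x * y) (y * x)]
  exact add_mem (hcomm x y) (M.mul_mem_left y hx)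

lemma norm_quotient_mul_le {B : Type*} [SeminormedRing B] {I : Ideal B} [I.IsTwoSided]
    (p q : B ⧸ I) : ‖p * q‖ ≤ ‖p‖ * ‖q‖ := by
  refine le_mul_of_forall_lt₀ fun r hr s hs => ?_
  obtain ⟨x, rfl, hx⟩ := Submodule.Quotient.norm_mk_lt p (sub_pos.2 hr)
  obtain ⟨y, rfl, hy⟩ := Submodule.Quotient.norm_mk_lt q (sub_pos.2 hs)
  rw [add_sub_cancel] at hx hy
  calc
    _ ≤ ‖x * y‖ := Submodule.Quotient.norm_mk_le I (x * y)
    _ ≤ ‖x‖ * ‖y‖ := norm_mul_le x y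
    _ ≤ r * s := by gcongr; exact (norm_nonneg x).trans hx.le

/-- The quotient of a normed ring by a closed two-sided ideal, with the quotient norm. Mathlib has
this structure only for commutative rings. -/
noncomputable abbrev quotientNormedRing {B : Type*} [NormedRing B] (I : Ideal B) [I.IsTwoSided]
    [IsClosed (I : Set B)] : NormedRing (B ⧸ I) where
  __ := Submodule.Quotient.normedAddCommGroup I
  __ := Ideal.Quotient.ring I
  norm_mul_le := norm_quotient_mul_le

theorem exists_algHom_forall_mem_eq_zero {B : Type*} [NormedRing B] [NormedAlgebra ℂ B]
    [CompleteSpace B] (M : Ideal B) [M.IsTwoSided] [M.IsMaximal] :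
    ∃ χ : B →ₐ[ℂ] ℂ, ∀ x ∈ M, χ x = 0 := by
  let _ : NormedRing (B ⧸ M) := quotientNormedRing M
  let _ : NormedAlgebra ℂ (B ⧸ M) :=
    { Submodule.Quotient.normedSpace M ℂ, Ideal.Quotient.algebra ℂ with }
  have isUnit_iff {q : B ⧸ M} : IsUnit q ↔ q ≠ 0 :=
    @isUnit_iff_ne_zero _ (Ideal.Quotient.groupWithZero M) q
  let gelfandMazur : ℂ ≃ₐ[ℂ] B ⧸ M := NormedRing.algEquivComplexOfComplete isUnit_iff
  exact ⟨gelfandMazur.symm.toAlgHom.comp (Ideal.Quotient.mkₐ ℂ M), fun x hx => by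
    simp [Ideal.Quotient.eq_zero_iff_mem.2 hx]⟩

end GelfandMazur

section ModularLeftIdeals

variable (𝕜 : Type*) {R : Type*} [CommRing 𝕜] [NonUnitalRing R] [Module 𝕜 R]
  [IsScalarTower 𝕜 R R] [SMulCommClass 𝕜 R R]

/-- The left ideal `{x | R x b ⊆ S}` of the unitization of `R`. Products in the unitization with a
factor in `R` lie in `R`, so `snd` only undoes the embedding of `R`. -/
def transporter (S : AddSubgroup R) (b : R) : Ideal (Unitization 𝕜 R) where
  carrier := {x | ∀ c : R, ((c : Unitization 𝕜 R) * x * b).snd ∈ S}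
  zero_mem' c := by simp [zero_mem]
  add_mem' hx hy c := by
    simpa only [mul_add, add_mul, Unitization.snd_add] using add_mem (hx c) (hy c)
  smul_mem' y x hx c := by
    have inr_mul : (((c : Unitization 𝕜 R) * y).snd : Unitization 𝕜 R) = c * y :=
      unitization_inr_snd_of_fst_eq_zero (by simp)
    rw [smul_eq_mul, ← mul_assoc, ← inr_mul]
    exact hx _

variable {𝕜} {S : AddSubgroup R} {b : R}

lemma mem_transporter {x : Unitization 𝕜 R} :
    x ∈ transporter 𝕜 S b ↔ ∀ c : R, ((c : Unitization 𝕜 R) * x * b).snd ∈ S :=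
  Iff.rfl

lemma lie_mem_transporter (hS : sandwich (commSubgroup R : Set R) ≤ S) (x y : Unitization 𝕜 R) :
    ⁅x, y⁆ ∈ transporter 𝕜 S b := by
  have lie_eq : ⁅x, y⁆ = ((⁅x.snd, y.snd⁆ : R) : Unitization 𝕜 R) := by
    ext
    · exact sub_eq_zero.2 (mul_comm x.fst y.fst)
    · change (x * y).snd - (y * x).snd = x.snd * y.snd - y.snd * x.snd
      rw [Unitization.snd_mul, Unitization.snd_mul]
      abel
  refine mem_transporter.2 fun c => ?_
  rw [lie_eq, ← Unitization.inr_mul, ← Unitization.inr_mul, Unitization.snd_inr]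
  exact hS (mul_mul_mem_sandwich (lie_mem_commSubgroup _ _) c b)

variable {u : R} (hub : u * b = b)
include hub

lemma inr_sub_one_mem_transporter : (u : Unitization 𝕜 R) - 1 ∈ transporter 𝕜 S b :=
  mem_transporter.2 fun c => by
    rw [mul_assoc, sub_mul, one_mul, ← Unitization.inr_mul, hub, sub_self, mul_zero]
    exact zero_mem S

lemma transporter_ne_top (hb : b ∉ S) : transporter 𝕜 S b ≠ ⊤ := by
  rw [Ne, Ideal.eq_top_iff_one, mem_transporter]
  intro h
  have u_mul_mem := h u
  rw [mul_one, ← Unitization.inr_mul, hub, Unitization.snd_inr] at u_mul_mem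
  exact hb u_mul_mem

end ModularLeftIdeals

section Characters

variable {A : Type*} [NonUnitalCStarAlgebra A]

lemma hasCharacter_of_algHom_ne_zero (χ : Unitization ℂ A →ₐ[ℂ] ℂ) {u : A}
    (hu : χ (u : Unitization ℂ A) ≠ 0) : HasCharacter A := by
  let χ' : Unitization ℂ A →⋆ₐ[ℂ] ℂ :=
    { χ with map_star' := (AlgHomClass.instStarHomClass (F := Unitization ℂ A →ₐ[ℂ] ℂ)).map_star χ }
  exact ⟨(χ' : Unitization ℂ A →⋆ₙₐ[ℂ] ℂ).comp (Unitization.inrNonUnitalStarAlgHom ℂ A),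
    fun h => hu (DFunLike.congr_fun h u)⟩

theorem hasCharacter_of_mul_eq {u b : A} (hub : u * b = b)
    (hb : b ∉ sandwich (commSubgroup A : Set A)) : HasCharacter A := by
  obtain ⟨M, hM, hle⟩ := Ideal.exists_le_maximal _ (transporter_ne_top (𝕜 := ℂ) hub hb)
  have : M.IsTwoSided := isTwoSided_of_lie_mem fun x y => hle (lie_mem_transporter le_rfl x y)
  obtain ⟨χ, hχ⟩ := exists_algHom_forall_mem_eq_zero M
  have map_eq_one : χ (u : Unitization ℂ A) = 1 := by
    simpa [sub_eq_zero] using hχ _ (hle (inr_sub_one_mem_transporter hub))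
  exact hasCharacter_of_algHom_ne_zero χ (u := u) (by simp [map_eq_one])

theorem not_hasCharacter_of_mulSpan_eq_top
    (h : mulSpan (commSubgroup A : Set A) (commSubgroup A : Set A) = ⊤) : ¬ HasCharacter A := by
  rintro ⟨χ, hχ⟩
  have commSubgroup_le_ker : commSubgroup A ≤ (χ : A →+ ℂ).ker := commSubgroup_le fun x y => by
    simp [AddMonoidHom.mem_ker, Ring.lie_def, mul_comm]
  have top_le_ker : ⊤ ≤ (χ : A →+ ℂ).ker := h.ge.trans <| mulSpan_le fun x hx y _ => by
    have map_eq_zero : χ x = 0 := commSubgroup_le_ker hx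
    simp [AddMonoidHom.mem_ker, map_eq_zero]
  exact hχ (NonUnitalStarAlgHom.ext fun a => top_le_ker (AddSubgroup.mem_top a))

theorem dense_sandwich_of_not_hasCharacter (h : ¬ HasCharacter A) :
    Dense (sandwich (commSubgroup A : Set A) : Set A) := by
  have setOf_subset : {b : A | ∃ u, u * b = b} ⊆ sandwich (commSubgroup A : Set A) :=
    fun b ⟨u, hub⟩ => by_contra fun hb => h (hasCharacter_of_mul_eq hub hb)
  exact mem_of_forall_smul_selfAdjoint_mem
    (S := (sandwich (commSubgroup A : Set A)).topologicalClosure) fun z a ha =>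
      map_mem_closure (continuous_const_smul z)
        (closure_mono setOf_subset (mem_closure_setOf_exists_mul_eq ha))
        fun x hx => smul_mem_sandwich z hx

end Characters

theorem mainTheorem3 (A : Type*) [NonUnitalCStarAlgebra A] :
    List.TFAE [
      -- (1) `A = Ã[A,A]Ã`, computed inside the unitization `Ã`
      (sandwich ((fun a : A => (a : Unitization ℂ A)) '' (commSubgroup A : Set A)) :
        Set (Unitization ℂ A)) = Set.range (fun a : A => (a : Unitization ℂ A)),
      -- (1) `A` is generated by its commutators as a (not necessarily closed) two-sided ideal
      TwoSidedIdeal.span (commSet A) = ⊤,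
      -- (2) `A = A[A,A]A`
      sandwich (commSubgroup A : Set A) = ⊤,
      -- (2) spelled out in elements
      ∀ a : A, ∃ (n : ℕ) (b c d e : Fin n → A), a = ∑ j, b j * ⁅c j, d j⁆ * e j,
      -- (3) `A = A[[A,A],[A,A]]A`
      sandwich (commSpan (commSubgroup A : Set A) (commSubgroup A : Set A) : Set A) = ⊤,
      -- (4) `A` is generated by its commutators as a ring
      NonUnitalSubring.closure (commSet A) = ⊤,
      -- (5) `A = [A,A]^2`
      mulSpan (commSubgroup A : Set A) (commSubgroup A : Set A) = ⊤,
      -- (5) spelled out in elements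
      ∀ a : A, ∃ (n : ℕ) (b c d e : Fin n → A), a = ∑ j, ⁅b j, c j⁆ * ⁅d j, e j⁆]
    -- these conditions imply (6): `A` has no character
    ∧ (mulSpan (commSubgroup A : Set A) (commSubgroup A : Set A) = ⊤ → ¬ HasCharacter A)
    -- (6) implies that `A[A,A]A` is dense in `A`
    ∧ (¬ HasCharacter A → Dense (sandwich (commSubgroup A : Set A) : Set A))
    -- if `A` is unital, then (6) is equivalent to the other conditions
    ∧ ((∃ u : A, ∀ a : A, u * a = a ∧ a * u = a) →
        (¬ HasCharacter A ↔ mulSpan (commSubgroup A : Set A) (commSubgroup A : Set A) = ⊤)) := by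
  have tfae := (hasNoNilQuotient_of_nonUnitalCStarAlgebra A).tfae_generated_by_commutators ℂ
  refine ⟨tfae, not_hasCharacter_of_mulSpan_eq_top, dense_sandwich_of_not_hasCharacter, ?_⟩
  rintro ⟨u, hu⟩
  refine ⟨fun h => (tfae.out 2 6).1 ((AddSubgroup.eq_top_iff' _).2 fun b => by_contra fun hb => ?_),
    not_hasCharacter_of_mulSpan_eq_top⟩
  exact h (hasCharacter_of_mul_eq (hu b).1 hb)
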